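/- Let $q$ be a prime power, let $\mathcal K=\mathbb F_{q^2}$ with $\bar x=x^q$, and let $\mathcal K^o=\{s\in\mathcal K:\bar s=-s\}$ and $\mathbb F_{q^2}^1=\{x\in\mathcal K: x\bar x=1\}$. Let $l\ge 2$, and let $d=2l$ ($q$ arbitrary) or $d=2l+1$ ($q$ odd). Index rows and columns of $d\times d$ matrices by $1,\dots,l,-1,\dots,-l$ if $d=2l$ and by $0,1,\dots,l,-1,\dots,-l$ if $d=2l+1$, and put $$\beta=\begin{pmatrix}0&I_l\\ I_l&0\end{pmatrix}\ (d=2l),\qquad \beta=\begin{pmatrix}2&0&0\\0&0&I_l\\0&I_l&0\end{pmatrix}\ (d=2l+1),$$ $$U(d,q^2)=\{X\in GL(d,\mathcal K): {}^T\bar X\beta X=\beta\}.$$ Let $e_{a,b}$ denote the matrix units. The elementary matrices are, for $1\le i,j\le l$, $t\in\mathcal K$, $s\in\mathcal K^o$: $I+te_{i,j}-\bar te_{-j,-i}$ ($i\ne j$), $I+te_{i,-j}-\bar te_{j,-i}$ ($i<j$), $I+te_{-i,j}-\bar te_{-j,i}$ ($i<j$), $I+se_{i,-i}$, $I+se_{-i,i}$,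 and, only for $d=2l+1$, also $I-2\bar te_{i,0}+te_{0,-i}-t\bar te_{i,-i}$ and $I+te_{0,i}-2\bar te_{-i,0}-t\bar te_{-i,i}$. **Theorem.** Let $\zeta$ be a generator of the cyclic group $\mathbb F_{q^2}^\times$ and let $\zeta_1=\zeta^{q-1}$. Then $\zeta_1$ generates $\mathbb F_{q^2}^1$, and: 1. if $d=2l$, then $U(d,q^2)$ is generated by the elementary matrices together with $h(\zeta)=\mathrm{diag}(1,\dots,1,\zeta,1,\dots,1,\bar\zeta^{-1})$, where $\zeta$ stands at index $l$ and $\bar\zeta^{-1}$ at index $-l$; 2. if $d=2l+1$ and $q$ is odd, then $U(d,q^2)$ is generated by the elementary matrices together with $h(\zeta)=\mathrm{diag}(1,1,\dots,1,\zeta,1,\dots,1,\bar\zeta^{-1})$, with $\zeta$ at index $l$ and $\bar\zeta^{-1}$ at index $-l$, and $h(\zeta_1)=\mathrm{diag}(\zeta_1,1,\dots,1)$, with $\zeta_1$ at index $0$. -/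

import Mathlib

open scoped Matrix

/-- The unitary group of a matrix `β` with respect to `σ : x ↦ x̄`:
all `X ∈ GL` with `ᵗX̄ β X = β`. -/
def unitaryGroupOf {K : Type*} [Field K] {m : Type*} [Fintype m] [DecidableEq m]
    (σ : K →+* K) (β : Matrix m m K) : Subgroup (GL m K) where
  carrier := {X | ((X : Matrix m m K).map σ)ᵀ * β * (X : Matrix m m K) = β}
  one_mem' := by simp
  mul_mem' := by
    intro X Y hX hY
    simp only [Set.mem_setOf_eq] at hX hY ⊢
    rw [Units.val_mul, Matrix.map_mul, Matrix.transpose_mul]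
    calc _ = ((Y : Matrix m m K).map σ)ᵀ *
          (((X : Matrix m m K).map σ)ᵀ * β * (X : Matrix m m K)) * (Y : Matrix m m K) := by
            simp only [Matrix.mul_assoc]
      _ = β := by rw [hX, hY]
  inv_mem' := by
    intro X hX
    simp only [Set.mem_setOf_eq] at hX ⊢
    have h1 : (X : Matrix m m K) * ((X⁻¹ : GL m K) : Matrix m m K) = 1 := X.mul_inv
    have h2 : (((X⁻¹ : GL m K) : Matrix m m K).map σ)ᵀ * ((X : Matrix m m K).map σ)ᵀ = 1 := by
      rw [← Matrix.transpose_mul, ← Matrix.map_mul, h1]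
      simp
    calc _ = (((X⁻¹ : GL m K) : Matrix m m K).map σ)ᵀ *
          (((X : Matrix m m K).map σ)ᵀ * β * (X : Matrix m m K)) *
            ((X⁻¹ : GL m K) : Matrix m m K) := by rw [hX]
      _ = ((((X⁻¹ : GL m K) : Matrix m m K).map σ)ᵀ * ((X : Matrix m m K).map σ)ᵀ) * β *
          ((X : Matrix m m K) * ((X⁻¹ : GL m K) : Matrix m m K)) := by
            simp only [Matrix.mul_assoc]
      _ = β := by rw [h1, h2, Matrix.one_mul, Matrix.mul_one]

/-- The index set `1, …, l, -1, …, -l`: `Sum.inl i` is the index `i`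
and `Sum.inr i` is the index `-i`. -/
abbrev EvenIndex (l : ℕ) : Type := Fin l ⊕ Fin l

/-- The index set `0, 1, …, l, -1, …, -l`. -/
abbrev OddIndex (l : ℕ) : Type := Unit ⊕ (Fin l ⊕ Fin l)

namespace OddIndex

/-- The index `0`. -/
abbrev zero {l : ℕ} : OddIndex l := Sum.inl ()

/-- The index `i`. -/
abbrev pos {l : ℕ} (i : Fin l) : OddIndex l := Sum.inr (Sum.inl i)

/-- The index `-i`. -/
abbrev neg {l : ℕ} (i : Fin l) : OddIndex l := Sum.inr (Sum.inr i)

end OddIndex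

/-- The split Hermitian form of size `2l`. -/
def evenForm (K : Type*) [Field K] (l : ℕ) : Matrix (EvenIndex l) (EvenIndex l) K :=
  Matrix.fromBlocks 0 1 1 0

/-- The split Hermitian form of size `2l + 1`, with the entry `2` at the place `(0, 0)`. -/
def oddForm (K : Type*) [Field K] (l : ℕ) : Matrix (OddIndex l) (OddIndex l) K :=
  Matrix.fromBlocks (Matrix.diagonal fun _ => 2) 0 0 (evenForm K l)

/-- The elementary matrices of the split unitary group of size `2l`. -/
inductive IsElementaryEven {K : Type*} [Field K] (σ : K →+* K) {l : ℕ} :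
    Matrix (EvenIndex l) (EvenIndex l) K → Prop
  | pos_pos (i j : Fin l) (t : K) (hij : i ≠ j) : IsElementaryEven σ
      (1 + Matrix.single (Sum.inl i) (Sum.inl j) t - Matrix.single (Sum.inr j) (Sum.inr i) (σ t))
  | pos_neg (i j : Fin l) (t : K) (hij : i < j) : IsElementaryEven σ
      (1 + Matrix.single (Sum.inl i) (Sum.inr j) t - Matrix.single (Sum.inl j) (Sum.inr i) (σ t))
  | neg_pos (i j : Fin l) (t : K) (hij : i < j) : IsElementaryEven σ
      (1 + Matrix.single (Sum.inr i) (Sum.inl j) t - Matrix.single (Sum.inr j) (Sum.inl i) (σ t))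
  | pos_neg_self (i : Fin l) (s : K) (hs : σ s = -s) : IsElementaryEven σ
      (1 + Matrix.single (Sum.inl i) (Sum.inr i) s)
  | neg_pos_self (i : Fin l) (s : K) (hs : σ s = -s) : IsElementaryEven σ
      (1 + Matrix.single (Sum.inr i) (Sum.inl i) s)

open OddIndex in
/-- The elementary matrices of the split unitary group of size `2l + 1`. -/
inductive IsElementaryOdd {K : Type*} [Field K] (σ : K →+* K) {l : ℕ} :
    Matrix (OddIndex l) (OddIndex l) K → Prop
  | pos_pos (i j : Fin l) (t : K) (hij : i ≠ j) : IsElementaryOdd σ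
      (1 + Matrix.single (pos i) (pos j) t - Matrix.single (neg j) (neg i) (σ t))
  | pos_neg (i j : Fin l) (t : K) (hij : i < j) : IsElementaryOdd σ
      (1 + Matrix.single (pos i) (neg j) t - Matrix.single (pos j) (neg i) (σ t))
  | neg_pos (i j : Fin l) (t : K) (hij : i < j) : IsElementaryOdd σ
      (1 + Matrix.single (neg i) (pos j) t - Matrix.single (neg j) (pos i) (σ t))
  | pos_neg_self (i : Fin l) (s : K) (hs : σ s = -s) : IsElementaryOdd σ
      (1 + Matrix.single (pos i) (neg i) s)
  | neg_pos_self (i : Fin l) (s : K) (hs : σ s = -s) : IsElementaryOdd σ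
      (1 + Matrix.single (neg i) (pos i) s)
  | pos_zero (i : Fin l) (t : K) : IsElementaryOdd σ
      (1 - Matrix.single (pos i) zero (2 * σ t) + Matrix.single zero (neg i) t
        - Matrix.single (pos i) (neg i) (t * σ t))
  | zero_pos (i : Fin l) (t : K) : IsElementaryOdd σ
      (1 + Matrix.single zero (pos i) t - Matrix.single (neg i) zero (2 * σ t)
        - Matrix.single (neg i) (pos i) (t * σ t))

/-- `diag(1, …, 1, z, 1, …, 1, z̄⁻¹)` of size `2l`: the entry `z` is at the index `l` and
`z̄⁻¹` at the index `-l`. -/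
def hEven {K : Type*} [Field K] (σ : K →+* K) (l : ℕ) (z : K) :
    Matrix (EvenIndex l) (EvenIndex l) K :=
  Matrix.diagonal (Sum.elim
    (fun i : Fin l => if (i : ℕ) + 1 = l then z else 1)
    (fun i : Fin l => if (i : ℕ) + 1 = l then (σ z)⁻¹ else 1))

/-- `diag(1, 1, …, 1, z, 1, …, 1, z̄⁻¹)` of size `2l + 1`: the entry `z` is at the index `l` and
`z̄⁻¹` at the index `-l`. -/
def hOdd {K : Type*} [Field K] (σ : K →+* K) (l : ℕ) (z : K) :
    Matrix (OddIndex l) (OddIndex l) K :=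
  Matrix.fromBlocks 1 0 0 (hEven σ l z)

/-- `diag(z, 1, …, 1)` of size `2l + 1`: the entry `z` is at the index `0`. -/
def hZero {K : Type*} [Field K] (l : ℕ) (z : K) : Matrix (OddIndex l) (OddIndex l) K :=
  Matrix.diagonal (Sum.elim (fun _ => z) (fun _ => 1))

/-- The group `{x ∈ Kˣ | x x̄ = 1}`. -/
def normOneSubgroup {K : Type*} [Field K] (σ : K →+* K) : Subgroup Kˣ where
  carrier := {x | (x : K) * σ x = 1}
  one_mem' := by simp
  mul_mem' := by
    intro x y hx hy
    simp only [Set.mem_setOf_eq, Units.val_mul, map_mul] at hx hy ⊢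
    rw [mul_mul_mul_comm, hx, hy, one_mul]
  inv_mem' := by
    intro x hx
    simp only [Set.mem_setOf_eq, Units.val_inv_eq_inv_val, map_inv₀] at hx ⊢
    rw [← mul_inv, hx, inv_one]

/-- The matrices in `S` all belong to the subgroup `G` of `GL` and generate it. -/
def GeneratedByMatrices {K : Type*} [Field K] {m : Type*} [Fintype m] [DecidableEq m]
    (G : Subgroup (GL m K)) (S : Set (Matrix m m K)) : Prop :=
  (∀ A ∈ S, ∃ g ∈ G, (g : Matrix m m K) = A) ∧
    Subgroup.closure {g : GL m K | (g : Matrix m m K) ∈ S} = G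

/-! Both forms are instances of one Hermitian form attached to an involution `ν` (written a ↦ -a) of
the index set: hyperbolic planes spanned by e_a and e_{-a}, together with at most one anisotropic
line spanned by e_o, on which 2 is invertible. For a subgroup `E` of the unitary group containing
the generators, Gaussian elimination by hyperbolic planes shows that `E` is the whole group.

Let the isometry X fix every e_b with b outside a set S stable under `ν`, and let a in S satisfy -a
≠ a. The vector X e_a is isotropic and supported on S. Elements of `E` fixing the basis outside S
give it the coordinate 1 at a, and root elements then turn it into e_a (`exists_mulVec_eq_single`);
here isotropy is what makes the last parameter skew. The image of e_{-a} now pairs to 1 with e_a, so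
its coordinate at -a is 1, and the same lemma turns it into e_{-a} by elements fixing e_a. Hence S
shrinks to S \ {a, -a} (`exists_reduce`).

The torus is given only at the index a₀, so the plane of a₀ is treated last: before that, short
roots produce the coordinate 1, and for the last plane a nonzero skew scalar and the torus do. What
remains is a scalar of norm one on the anisotropic line.

Finiteness of the field enters through cyclicity: powers of h(ζ) give the whole torus at a₀, powers
of ζ^(q-1) give all elements of norm one, and ζ - ζ̄ is a nonzero skew scalar in every
characteristic. -/

/-! ### The split Hermitian form and the isometry of its generators. -/

section SplitForm

variable {K : Type*} [Field K] {m : Type*} [Fintype m] [DecidableEq m]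

/-- The Hermitian form attached to an involution `ν` of the index set: the indices moved by `ν`
are paired into hyperbolic planes, the fixed ones carry the entry `2`. -/
def splitForm (K : Type*) [Field K] {m : Type*} [DecidableEq m] (ν : m → m) : Matrix m m K :=
  Matrix.of fun a b => if b = ν a then (if b = a then 2 else 1) else 0

/-- The matrix `1 + t e_{a,b} - t̄ e_{-b,-a}`. -/
def shortRoot (σ : K →+* K) (ν : m → m) (a b : m) (t : K) : Matrix m m K :=
  1 + Matrix.single a b t - Matrix.single (ν b) (ν a) (σ t)

/-- The matrix `1 + s e_{a,-a}`. -/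
def longRoot (ν : m → m) (a : m) (s : K) : Matrix m m K :=
  1 + Matrix.single a (ν a) s

/-- The matrix `1 - 2 t̄ e_{a,o} + t e_{o,-a} - t t̄ e_{a,-a}`. -/
def extraRoot (σ : K →+* K) (ν : m → m) (o a : m) (t : K) : Matrix m m K :=
  1 - Matrix.single a o (2 * σ t) + Matrix.single o (ν a) t - Matrix.single a (ν a) (t * σ t)

/-- The diagonal of the torus element with `z` at `a` and `z̄⁻¹` at `-a`. -/
def torusDiag (σ : K →+* K) (ν : m → m) (a : m) (z : K) : m → K :=
  fun b => if b = a then z else if b = ν a then (σ z)⁻¹ else 1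

theorem splitForm_mulVec (ν : m → m) (v : m → K) (a : m) :
    (splitForm K ν *ᵥ v) a = (if ν a = a then 2 else 1) * v (ν a) := by
  simp [splitForm, Matrix.mulVec, dotProduct]

theorem splitForm_mul_single {ν : m → m} (hν : Function.Involutive ν) (a b : m) (t : K) :
    splitForm K ν * Matrix.single a b t =
      Matrix.single (ν a) b ((if ν a = a then 2 else 1) * t) := by
  ext i j
  by_cases hj : j = b
  · subst hj
    rw [Matrix.mul_single_apply_same]
    by_cases hi : i = ν a
    · subst hi
      simp [splitForm, hν a, eq_comm]
    · have : a ≠ ν i := fun h => hi (by rw [h, hν])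
      simp [splitForm, this, Ne.symm hi]
  · rw [Matrix.mul_single_apply_of_ne _ _ _ _ _ hj]
    simp [Ne.symm hj]

theorem single_mul_splitForm {ν : m → m} (a b : m) (t : K) :
    Matrix.single a b t * splitForm K ν =
      Matrix.single a (ν b) (t * (if ν b = b then 2 else 1)) := by
  ext i j
  by_cases hi : i = a
  · subst hi
    rw [Matrix.single_mul_apply_same]
    by_cases hj : j = ν b
    · subst hj
      simp [splitForm]
    · simp [splitForm, hj, Ne.symm hj]
  · rw [Matrix.single_mul_apply_of_ne _ _ _ _ _ hi]
    simp [Ne.symm hi]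

theorem exists_mem_unitaryGroupOf {σ : K →+* K} {β A : Matrix m m K} (hβ : IsUnit β.det)
    (hA : (A.map σ)ᵀ * β * A = β) : ∃ g ∈ unitaryGroupOf σ β, (g : Matrix m m K) = A := by
  have : IsUnit A.det := by
    rw [← hA, Matrix.det_mul] at hβ
    exact isUnit_of_mul_isUnit_right hβ
  exact ⟨Matrix.GeneralLinearGroup.mk'' A this, hA, rfl⟩

theorem isUnit_det_splitForm {ν : m → m} (hν : Function.Involutive ν)
    (h2 : ∀ o, ν o = o → (2 : K) ≠ 0) : IsUnit (splitForm K ν).det := by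
  -- The inverse is the same matrix with 1/2 in place of 2.
  have : splitForm K ν * (Matrix.of fun a b => if b = ν a then (if b = a then 2⁻¹ else 1) else 0)
      = 1 := by
    ext a b
    rw [Matrix.mul_apply, Finset.sum_eq_single (ν a)]
    · by_cases ha : ν a = a
      · by_cases hb : b = a
        · subst hb
          simp [splitForm, ha, h2 _ ha]
        · simp [splitForm, ha, hb, Ne.symm hb]
      · by_cases hb : b = a
        · subst hb
          simp [splitForm, ha, hν b, Ne.symm ha]
        · simp [splitForm, ha, hν a, hb, Ne.symm hb]
    · intro c _ hc
      simp [splitForm, hc]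
    · simp
  have h := congrArg Matrix.det this
  rw [Matrix.det_mul, Matrix.det_one] at h
  exact IsUnit.of_mul_eq_one _ h

variable {σ : K →+* K} {ν : m → m}

theorem shortRoot_isometry (hσ : ∀ x, σ (σ x) = x) (hν : Function.Involutive ν) {a b : m}
    (ha : ν a ≠ a) (hb : ν b ≠ b) (hab : a ≠ b) (hab' : a ≠ ν b) (t : K) :
    ((shortRoot σ ν a b t).map σ)ᵀ * splitForm K ν * shortRoot σ ν a b t = splitForm K ν := by
  have h1 : ((shortRoot σ ν a b t).map σ)ᵀ =
      1 + Matrix.single b a (σ t) - Matrix.single (ν a) (ν b) t := by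
    simp [shortRoot, Matrix.map_add, Matrix.map_sub, Matrix.map_single, Matrix.transpose_sub,
      Matrix.transpose_add, hσ]
  have h3 : ν a ≠ b := fun h => hab' (by rw [← h, hν])
  have h4 : ν a ≠ ν b := fun h => hab (hν.injective h)
  rw [h1, shortRoot]
  simp [add_mul, sub_mul, mul_add, mul_sub, splitForm_mul_single hν, single_mul_splitForm, hν b,
    ha, hb.symm, Matrix.single_mul_single_of_ne, h4, hab.symm]

theorem longRoot_isometry (hν : Function.Involutive ν) {a : m}
    (ha : ν a ≠ a) {s : K} (hs : σ s = -s) :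
    ((longRoot ν a s).map σ)ᵀ * splitForm K ν * longRoot ν a s = splitForm K ν := by
  have h1 : ((longRoot ν a s).map σ)ᵀ = 1 - Matrix.single (ν a) a s := by
    simp [longRoot, Matrix.map_add, Matrix.transpose_add, Matrix.map_single, hs, sub_eq_add_neg,
      ← Matrix.single_neg]
  rw [h1, longRoot]
  simp [sub_mul, mul_add, splitForm_mul_single hν, single_mul_splitForm, ha,
    Matrix.single_mul_single_of_ne]

/-- The image of e_{-a} is e_{-a} + t e_o - t t̄ e_a. It stays isotropic because the value 2 t t̄ on
the anisotropic line cancels the two cross terms -t t̄; the coefficient -2 t̄ keeps the image of e_o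
orthogonal to it. -/
theorem extraRoot_isometry (hσ : ∀ x, σ (σ x) = x) (hν : Function.Involutive ν) {o a : m}
    (ho : ν o = o) (ha : ν a ≠ a) (t : K) :
    ((extraRoot σ ν o a t).map σ)ᵀ * splitForm K ν * extraRoot σ ν o a t = splitForm K ν := by
  have h1 : ((extraRoot σ ν o a t).map σ)ᵀ =
      1 - Matrix.single o a (2 * t) + Matrix.single (ν a) o (σ t)
        - Matrix.single (ν a) a (t * σ t) := by
    simp [extraRoot, Matrix.map_add, Matrix.map_sub, Matrix.map_single, Matrix.transpose_sub,
      Matrix.transpose_add, hσ, mul_comm, map_ofNat]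
  have hoa : o ≠ a := by rintro rfl; exact ha ho
  have hoa' : o ≠ ν a := by rintro rfl; exact ha (hν.injective ho)
  rw [h1, extraRoot]
  simp [add_mul, sub_mul, mul_add, mul_sub, splitForm_mul_single hν, single_mul_splitForm, ha, ho,
    Matrix.single_mul_single_of_ne, hoa, hoa'.symm]
  ext i j
  simp [Matrix.single_apply]
  split_ifs <;> ring

theorem torusDiag_isometry (hσ : ∀ x, σ (σ x) = x) (hν : Function.Involutive ν) {a : m}
    (ha : ν a ≠ a) {z : K} (hz : z ≠ 0) :
    ((Matrix.diagonal (torusDiag σ ν a z)).map σ)ᵀ * splitForm K ν *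
      Matrix.diagonal (torusDiag σ ν a z) = splitForm K ν := by
  have hz' : σ z ≠ 0 := by simpa using hz
  ext i j
  rw [Matrix.diagonal_map (map_zero σ), Matrix.diagonal_transpose, Matrix.mul_diagonal,
    Matrix.diagonal_mul]
  by_cases hj : j = ν i
  · subst hj
    by_cases h1 : i = a
    · subst h1; simp [torusDiag, ha, hz', mul_comm (σ z)]
    · by_cases h2 : i = ν a
      · subst h2; simp [torusDiag, ha, hν a, hσ, hz, mul_comm _ z]
      · have h3 : ν i ≠ a := fun h => h2 (by rw [← h, hν])
        have h4 : ν i ≠ ν a := fun h => h1 (hν.injective h)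
        simp [torusDiag, h1, h2, h3, h4]
  · simp [splitForm, hj]

theorem normOneDiag_isometry {o : m} (hν : Function.Involutive ν)
    (ho : ν o = o) {z : K} (hz : z * σ z = 1) :
    ((Matrix.diagonal (Function.update (fun _ : m => (1 : K)) o z)).map σ)ᵀ * splitForm K ν *
      Matrix.diagonal (Function.update (fun _ : m => (1 : K)) o z) = splitForm K ν := by
  ext i j
  rw [Matrix.diagonal_map (map_zero σ), Matrix.diagonal_transpose, Matrix.mul_diagonal,
    Matrix.diagonal_mul]
  by_cases hj : j = ν i
  · subst hj
    by_cases h1 : i = o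
    · subst h1
      rw [ho]
      simp only [Function.update_self]
      linear_combination (splitForm K ν i i) * hz
    · have h4 : ν i ≠ o := fun h => h1 (hν.injective (h.trans ho.symm))
      simp [h1, h4, Function.update_of_ne]
  · simp [splitForm, hj]

end SplitForm

/-! ### Moving isotropic vectors by generators. -/

section Generation

variable {K : Type*} [Field K] {m : Type*} [Fintype m] [DecidableEq m]

/-- The value at `(u, v)` of the Hermitian form with matrix `β`. -/
def hermitianValue (σ : K →+* K) (β : Matrix m m K) (u v : m → K) : K :=
  (fun a => σ (u a)) ⬝ᵥ (β *ᵥ v)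

theorem hermitianValue_mulVec {σ : K →+* K} {β : Matrix m m K} {g : GL m K}
    (hg : g ∈ unitaryGroupOf σ β) (u v : m → K) :
    hermitianValue σ β ((g : Matrix m m K) *ᵥ u) ((g : Matrix m m K) *ᵥ v) =
      hermitianValue σ β u v := by
  have h1 : (fun a => σ (((g : Matrix m m K) *ᵥ u) a)) =
      ((g : Matrix m m K).map σ) *ᵥ (fun a => σ (u a)) := by
    ext a
    simp [Matrix.mulVec, dotProduct, map_sum]
  have h2 : ((g : Matrix m m K).map σ)ᵀ * β * (g : Matrix m m K) = β := hg
  rw [hermitianValue, h1, hermitianValue, ← Matrix.vecMul_transpose, ← Matrix.dotProduct_mulVec,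
    Matrix.mulVec_mulVec, Matrix.mulVec_mulVec, h2]

theorem hermitianValue_single_left (σ : K →+* K) (ν : m → m) (a : m) (v : m → K) :
    hermitianValue σ (splitForm K ν) (Pi.single a 1) v =
      (if ν a = a then 2 else 1) * v (ν a) := by
  have : (fun b => σ ((Pi.single a 1 : m → K) b)) = Pi.single a 1 := by
    ext b
    by_cases h : b = a
    · subst h; simp
    · simp [h]
  rw [hermitianValue, this, single_one_dotProduct, splitForm_mulVec]

theorem hermitianValue_single_self (σ : K →+* K) {ν : m → m} {o : m} (ho : ν o = o) (x : K) :
    hermitianValue σ (splitForm K ν) (Pi.single o x) (Pi.single o x) = 2 * (x * σ x) := by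
  have : (fun b => σ ((Pi.single o x : m → K) b)) = Pi.single o (σ x) := by
    ext b
    by_cases h : b = o
    · subst h; simp
    · simp [h]
  rw [hermitianValue, this, single_dotProduct, splitForm_mulVec, ho]
  simp
  ring

theorem hermitianValue_single_add_single (σ : K →+* K) {ν : m → m} (hν : Function.Involutive ν)
    {a : m} (ha : ν a ≠ a) (x y : K) :
    hermitianValue σ (splitForm K ν) (Pi.single a x + Pi.single (ν a) y)
      (Pi.single a x + Pi.single (ν a) y) = σ x * y + σ y * x := by
  have : (fun b => σ ((Pi.single a x + Pi.single (ν a) y : m → K) b)) =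
      Pi.single a (σ x) + Pi.single (ν a) (σ y) := by
    ext b
    by_cases h : b = a
    · subst h; simp [ha.symm]
    · by_cases h' : b = ν a
      · subst h'; simp [ha]
      · simp [h, h']
  rw [hermitianValue, this, add_dotProduct, single_dotProduct, single_dotProduct,
    splitForm_mulVec, splitForm_mulVec]
  simp [ha, ha.symm, hν a]

/-- The elements of `E` that fix the basis vectors outside `S`. -/
def fixingOutside (E : Subgroup (GL m K)) (S : Set m) : Subgroup (GL m K) where
  carrier := {g | g ∈ E ∧ ∀ b, b ∉ S → (g : Matrix m m K) *ᵥ Pi.single b 1 = Pi.single b 1}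
  one_mem' := ⟨E.one_mem, fun b _ => by rw [Units.val_one, Matrix.one_mulVec]⟩
  mul_mem' := by
    rintro g h ⟨hg, hg'⟩ ⟨hh, hh'⟩
    refine ⟨E.mul_mem hg hh, fun b hb => ?_⟩
    rw [Units.val_mul, ← Matrix.mulVec_mulVec, hh' b hb, hg' b hb]
  inv_mem' := by
    rintro g ⟨hg, hg'⟩
    refine ⟨E.inv_mem hg, fun b hb => ?_⟩
    conv_lhs => rw [← hg' b hb]
    rw [Matrix.mulVec_mulVec, ← Units.val_mul, inv_mul_cancel, Units.val_one, Matrix.one_mulVec]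

theorem fixingOutside_mono {E : Subgroup (GL m K)} {S T : Set m} (h : S ⊆ T) :
    fixingOutside E S ≤ fixingOutside E T :=
  fun _ hg => ⟨hg.1, fun b hb => hg.2 b fun h' => hb (h h')⟩

theorem shortRoot_mulVec_apply (σ : K →+* K) (ν : m → m) (a b : m) (t : K) (v : m → K) (c : m) :
    (shortRoot σ ν a b t *ᵥ v) c =
      v c + (if c = a then t * v b else 0) - (if c = ν b then σ t * v (ν a) else 0) := by
  simp [shortRoot, Matrix.sub_mulVec, Matrix.add_mulVec, Matrix.single_mulVec,
    Function.update_apply]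

theorem longRoot_mulVec_apply (ν : m → m) (a : m) (s : K) (v : m → K) (c : m) :
    (longRoot ν a s *ᵥ v) c = v c + (if c = a then s * v (ν a) else 0) := by
  simp [longRoot, Matrix.add_mulVec, Matrix.single_mulVec, Function.update_apply]

theorem extraRoot_mulVec_apply (σ : K →+* K) (ν : m → m) (o a : m) (t : K) (v : m → K) (c : m) :
    (extraRoot σ ν o a t *ᵥ v) c =
      v c - (if c = a then 2 * σ t * v o else 0) + (if c = o then t * v (ν a) else 0)
        - (if c = a then t * σ t * v (ν a) else 0) := by
  simp [extraRoot, Matrix.sub_mulVec, Matrix.add_mulVec, Matrix.single_mulVec,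
    Function.update_apply]

/-- `E` is a group of isometries of the split form that contains the root elements, the torus
elements at the index `a₀` and the unitary scalars on the anisotropic line. -/
structure ContainsSplitGenerators (σ : K →+* K) (ν : m → m) (a₀ : m) (E : Subgroup (GL m K)) :
    Prop where
  le_unitary : E ≤ unitaryGroupOf σ (splitForm K ν)
  short : ∀ a b t, ν a ≠ a → ν b ≠ b → a ≠ b → a ≠ ν b →
    ∃ g ∈ E, (g : Matrix m m K) = shortRoot σ ν a b t
  long : ∀ a s, ν a ≠ a → σ s = -s → ∃ g ∈ E, (g : Matrix m m K) = longRoot ν a s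
  extra : ∀ o a t, ν o = o → ν a ≠ a → ∃ g ∈ E, (g : Matrix m m K) = extraRoot σ ν o a t
  torus : ∀ z, z ≠ 0 → ∃ g ∈ E, (g : Matrix m m K) = Matrix.diagonal (torusDiag σ ν a₀ z)
  normOne : ∀ o z, ν o = o → z * σ z = 1 →
    ∃ g ∈ E, (g : Matrix m m K) = Matrix.diagonal (Function.update (fun _ : m => (1 : K)) o z)

namespace ContainsSplitGenerators

variable {σ : K →+* K} {ν : m → m} {a₀ : m} {E : Subgroup (GL m K)} {S : Set m}

/-- Only the columns b and -a of this root element differ from those of the identity, so only these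
indices have to lie in S. This allows sets S not stable under `ν`, such as S \ {a}, which express
that one vector of a hyperbolic pair is fixed. -/
theorem exists_short (hE : ContainsSplitGenerators σ ν a₀ E)
    {a b : m} (t : K) (ha : ν a ≠ a) (hb : ν b ≠ b) (hab : a ≠ b) (hab' : a ≠ ν b)
    (hbS : b ∈ S) (haS : ν a ∈ S) :
    ∃ g ∈ fixingOutside E S, (g : Matrix m m K) = shortRoot σ ν a b t := by
  obtain ⟨g, hg, h⟩ := hE.short a b t ha hb hab hab'
  refine ⟨g, ⟨hg, fun c hc => ?_⟩, h⟩
  have h1 : c ≠ b := fun h => hc (h ▸ hbS)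
  have h2 : c ≠ ν a := fun h => hc (h ▸ haS)
  ext d
  rw [h, shortRoot_mulVec_apply]
  simp [h1.symm, h2.symm]

theorem exists_long (hE : ContainsSplitGenerators σ ν a₀ E)
    {a : m} {s : K} (ha : ν a ≠ a) (hs : σ s = -s) (haS : ν a ∈ S) :
    ∃ g ∈ fixingOutside E S, (g : Matrix m m K) = longRoot ν a s := by
  obtain ⟨g, hg, h⟩ := hE.long a s ha hs
  refine ⟨g, ⟨hg, fun c hc => ?_⟩, h⟩
  have h2 : c ≠ ν a := fun h => hc (h ▸ haS)
  ext d
  rw [h, longRoot_mulVec_apply]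
  simp [h2.symm]

theorem exists_extra (hE : ContainsSplitGenerators σ ν a₀ E)
    {o a : m} (t : K) (ho : ν o = o) (ha : ν a ≠ a) (hoS : o ∈ S) (haS : ν a ∈ S) :
    ∃ g ∈ fixingOutside E S, (g : Matrix m m K) = extraRoot σ ν o a t := by
  obtain ⟨g, hg, h⟩ := hE.extra o a t ho ha
  refine ⟨g, ⟨hg, fun c hc => ?_⟩, h⟩
  have h1 : c ≠ o := fun h => hc (h ▸ hoS)
  have h2 : c ≠ ν a := fun h => hc (h ▸ haS)
  ext d
  rw [h, extraRoot_mulVec_apply]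
  simp [h1.symm, h2.symm]

theorem exists_torus (hE : ContainsSplitGenerators σ ν a₀ E)
    {z : K} (hz : z ≠ 0) (h1 : a₀ ∈ S) (h2 : ν a₀ ∈ S) :
    ∃ g ∈ fixingOutside E S, (g : Matrix m m K) = Matrix.diagonal (torusDiag σ ν a₀ z) := by
  obtain ⟨g, hg, h⟩ := hE.torus z hz
  refine ⟨g, ⟨hg, fun c hc => ?_⟩, h⟩
  have h1 : c ≠ a₀ := fun h => hc (h ▸ h1)
  have h2 : c ≠ ν a₀ := fun h => hc (h ▸ h2)
  ext d
  rw [h, Matrix.mulVec_diagonal]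
  by_cases hd : d = c
  · subst hd; simp [torusDiag, h1, h2]
  · simp [hd]

theorem mulVec_isotropic (hE : ContainsSplitGenerators σ ν a₀ E) {g : GL m K}
    (hg : g ∈ fixingOutside E S) {v : m → K} (hv : hermitianValue σ (splitForm K ν) v v = 0) :
    hermitianValue σ (splitForm K ν) ((g : Matrix m m K) *ᵥ v) ((g : Matrix m m K) *ᵥ v) = 0 := by
  rw [hermitianValue_mulVec (hE.le_unitary hg.1), hv]

/-- One coordinate of `v` is cleared by means of the coordinate `v (-a) = 1`. -/
theorem exists_clear_coordinate (hE : ContainsSplitGenerators σ ν a₀ E)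
    (hν : Function.Involutive ν) (hS : ∀ b, ν b ∈ S ↔ b ∈ S) {a : m} (ha : ν a ≠ a) (haS : a ∈ S)
    {b : m} (hba : b ≠ a) (hba' : b ≠ ν a) {v : m → K} (hv : v (ν a) = 1)
    (hvS : ∀ c, c ∉ S → v c = 0) :
    ∃ g ∈ fixingOutside E (S \ {a}), ((g : Matrix m m K) *ᵥ v) b = 0 ∧
      ∀ c, c ≠ a → c ≠ b → ((g : Matrix m m K) *ᵥ v) c = v c := by
  have haS' : ν a ∈ S \ {a} := ⟨(hS a).2 haS, ha⟩
  by_cases hbS : b ∈ S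
  · by_cases hb : ν b = b
    · obtain ⟨g, hg, h⟩ := hE.exists_extra (S := S \ {a}) (-v b) hb ha ⟨hbS, hba⟩ haS'
      refine ⟨g, hg, ?_, fun c hc hc' => ?_⟩
      · rw [h, extraRoot_mulVec_apply]
        simp [hba, hv]
      · rw [h, extraRoot_mulVec_apply]
        simp [hc, hc']
    · have hb' : ν b ≠ a := fun h => hba' (by rw [← h, hν])
      obtain ⟨g, hg, h⟩ := hE.exists_short (S := S \ {a}) (a := b) (b := ν a) (-v b) hb
        (by rw [hν]; exact ha.symm) hba' (by rwa [hν]) haS' ⟨(hS b).2 hbS, hb'⟩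
      refine ⟨g, hg, ?_, fun c hc hc' => ?_⟩
      · rw [h, shortRoot_mulVec_apply]
        simp [hv, hν a, hba]
      · rw [h, shortRoot_mulVec_apply]
        simp [hc, hc', hν a]
  · exact ⟨1, Subgroup.one_mem _, by simp [hvS b hbS], by simp⟩

theorem exists_clear_coordinates (hE : ContainsSplitGenerators σ ν a₀ E)
    (hν : Function.Involutive ν) (hS : ∀ b, ν b ∈ S ↔ b ∈ S) {a : m} (ha : ν a ≠ a) (haS : a ∈ S)
    (T : Finset m) (haT : a ∉ T) (haT' : ν a ∉ T) {v : m → K} (hv : v (ν a) = 1)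
    (hvS : ∀ c, c ∉ S → v c = 0) :
    ∃ g ∈ fixingOutside E (S \ {a}), (∀ b ∈ T, ((g : Matrix m m K) *ᵥ v) b = 0) ∧
      ∀ c, c ≠ a → c ∉ T → ((g : Matrix m m K) *ᵥ v) c = v c := by
  induction T using Finset.induction_on with
  | empty => exact ⟨1, Subgroup.one_mem _, by simp, by simp⟩
  | insert b T hb ih =>
    rw [Finset.mem_insert, not_or] at haT haT'
    obtain ⟨g, hg, h0, h1⟩ := ih haT.2 haT'.2
    have h2 : ∀ c, c ∉ S → ((g : Matrix m m K) *ᵥ v) c = 0 := by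
      intro c hc
      by_cases hcT : c ∈ T
      · exact h0 c hcT
      · rw [h1 c (fun h => hc (h ▸ haS)) hcT, hvS c hc]
    obtain ⟨g', hg', h0', h1'⟩ := hE.exists_clear_coordinate hν hS ha haS (Ne.symm haT.1)
      (Ne.symm haT'.1) (v := (g : Matrix m m K) *ᵥ v) (by rw [h1 _ ha haT'.2, hv]) h2
    refine ⟨g' * g, Subgroup.mul_mem _ hg' hg, fun c hc => ?_, fun c hc hc' => ?_⟩
    · rw [Units.val_mul, ← Matrix.mulVec_mulVec]
      rcases Finset.mem_insert.1 hc with rfl | hc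
      · exact h0'
      · rw [h1' c (fun h => haT.2 (h ▸ hc)) (fun h => hb (h ▸ hc)), h0 c hc]
    · rw [Finset.mem_insert, not_or] at hc'
      rw [Units.val_mul, ← Matrix.mulVec_mulVec, h1' c hc hc'.1, h1 c hc hc'.2]

/-- An isotropic vector with coordinate `1` at `-a` is moved to the basis vector at `-a` by
generators that fix the basis vector at `a`. -/
theorem exists_mulVec_eq_single (hE : ContainsSplitGenerators σ ν a₀ E)
    (hν : Function.Involutive ν) (hS : ∀ b, ν b ∈ S ↔ b ∈ S) {a : m} (ha : ν a ≠ a) (haS : a ∈ S)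
    {v : m → K} (hv : v (ν a) = 1) (hvS : ∀ c, c ∉ S → v c = 0)
    (hv0 : hermitianValue σ (splitForm K ν) v v = 0) :
    ∃ g ∈ fixingOutside E (S \ {a}), (g : Matrix m m K) *ᵥ v = Pi.single (ν a) 1 := by
  obtain ⟨g, hg, h0, h1⟩ := hE.exists_clear_coordinates hν hS ha haS
    ((Finset.univ.erase a).erase (ν a)) (by simp) (by simp) hv hvS
  have h2 : (g : Matrix m m K) *ᵥ v =
      Pi.single a (((g : Matrix m m K) *ᵥ v) a) + Pi.single (ν a) 1 := by
    ext b
    by_cases hb : b = a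
    · subst hb; simp [ha.symm]
    · by_cases hb' : b = ν a
      · subst hb'
        rw [h1 _ hb (by simp), hv]
        simp [ha]
      · rw [h0 b (by simp [hb, hb'])]
        simp [hb, hb']
  set x := ((g : Matrix m m K) *ᵥ v) a with hx
  have h3 := hE.mulVec_isotropic hg hv0
  rw [h2, hermitianValue_single_add_single σ hν ha] at h3
  -- Isotropy of x e_a + e_{-a} reads x̄ + x = 0, so -x is an admissible long root parameter.
  have hs : σ (-x) = -(-x) := by
    rw [map_neg]
    simp only [map_one, mul_one, one_mul] at h3
    linear_combination -h3
  obtain ⟨g', hg', h⟩ := hE.exists_long (S := S \ {a}) ha hs ⟨(hS a).2 haS, ha⟩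
  refine ⟨g' * g, Subgroup.mul_mem _ hg' hg, ?_⟩
  rw [Units.val_mul, ← Matrix.mulVec_mulVec, h2, h]
  ext b
  rw [longRoot_mulVec_apply]
  by_cases hb : b = a
  · subst hb; simp [ha, ha.symm]
  · simp [hb]

end ContainsSplitGenerators

end Generation

/-! ### Splitting off hyperbolic planes. -/

section Reduction

variable {K : Type*} [Field K] {m : Type*} [Fintype m] [DecidableEq m]
  {σ : K →+* K} {ν : m → m}

/-- Otherwise v would be a multiple x e_o, and its form value 2 x x̄ vanishes only for x = 0. -/
theorem exists_hyperbolic_coordinate_ne_zero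
    (ho : ∀ o o', ν o = o → ν o' = o' → o = o') (h2 : ∀ o, ν o = o → (2 : K) ≠ 0)
    {v : m → K} (hv : v ≠ 0) (hv0 : hermitianValue σ (splitForm K ν) v v = 0) :
    ∃ b, ν b ≠ b ∧ v b ≠ 0 := by
  by_contra! h
  obtain ⟨o, hvo⟩ := Function.ne_iff.1 hv
  have hνo : ν o = o := by
    by_contra h'
    exact hvo (h o h')
  have hvs : v = Pi.single o (v o) := by
    ext b
    by_cases hb : b = o
    · subst hb; simp
    · rw [Pi.single_eq_of_ne hb]
      exact h b fun hb' => hb (ho b o hb' hνo)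
  rw [hvs, hermitianValue_single_self σ hνo] at hv0
  simp only [mul_eq_zero, map_eq_zero, or_self] at hv0
  exact hv0.elim (h2 o hνo) hvo

/-- The coordinate at b is, up to the factor 1 or 2, the pairing with e_{-b}. As -b is outside S, X
fixes e_{-b} and preserves its orthogonality to e_a. -/
theorem mulVec_single_apply_eq_zero (hν : Function.Involutive ν)
    (h2 : ∀ o, ν o = o → (2 : K) ≠ 0) {S : Set m} (hS : ∀ b, ν b ∈ S ↔ b ∈ S) {X : GL m K}
    (hX : X ∈ fixingOutside (unitaryGroupOf σ (splitForm K ν)) S) {a b : m} (ha : a ∈ S)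
    (hb : b ∉ S) : ((X : Matrix m m K) *ᵥ Pi.single a 1) b = 0 := by
  have h := hermitianValue_mulVec hX.1 (Pi.single (ν b) 1) (Pi.single a 1)
  rw [hX.2 (ν b) (fun h => hb ((hS b).1 h)), hermitianValue_single_left,
    hermitianValue_single_left, hν b, Pi.single_eq_of_ne (show b ≠ a from fun h => hb (h ▸ ha)), mul_zero] at h
  refine (mul_eq_zero.1 h).resolve_left ?_
  split_ifs with h'
  · exact h2 b h'.symm
  · exact one_ne_zero

theorem mulVec_single_ne_zero (X : GL m K) (a : m) :
    (X : Matrix m m K) *ᵥ Pi.single a 1 ≠ 0 := by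
  intro h
  have h1 : ((X⁻¹ : GL m K) : Matrix m m K) *ᵥ ((X : Matrix m m K) *ᵥ Pi.single a 1) =
      Pi.single a 1 := by
    rw [Matrix.mulVec_mulVec, ← Units.val_mul, inv_mul_cancel, Units.val_one, Matrix.one_mulVec]
  rw [h, Matrix.mulVec_zero] at h1
  simpa using congrFun h1 a

namespace ContainsSplitGenerators

variable {a₀ : m} {E : Subgroup (GL m K)} {S : Set m}

theorem exists_unit_coordinate_of_ne_zero (hE : ContainsSplitGenerators σ ν a₀ E)
    (hS : ∀ b, ν b ∈ S ↔ b ∈ S) {a b : m} (ha : ν a ≠ a) (hb : ν b ≠ b) (haS : a ∈ S)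
    (hbS : b ∈ S) (hab : a ≠ b) (hab' : a ≠ ν b) {v : m → K} (hv : v b ≠ 0) :
    ∃ g ∈ fixingOutside E S, ((g : Matrix m m K) *ᵥ v) a = 1 := by
  obtain ⟨g, hg, h⟩ := hE.exists_short (S := S) ((1 - v a) / v b) ha hb hab hab' hbS
    ((hS a).2 haS)
  refine ⟨g, hg, ?_⟩
  rw [h, shortRoot_mulVec_apply]
  simp [hab', hv]

/-- With a second hyperbolic pair ±b available, short roots suffice and no torus is needed. If the
known nonzero coordinate lies at ±a, it is first copied to b. -/
theorem exists_unit_coordinate (hE : ContainsSplitGenerators σ ν a₀ E)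
    (hν : Function.Involutive ν)
    (hS : ∀ b, ν b ∈ S ↔ b ∈ S) {a b : m} (ha : ν a ≠ a) (hb : ν b ≠ b) (haS : a ∈ S)
    (hbS : b ∈ S) (hab : a ≠ b) (hab' : a ≠ ν b) {v : m → K} (hv : ∃ c, ν c ≠ c ∧ v c ≠ 0)
    (hvS : ∀ c, c ∉ S → v c = 0) :
    ∃ g ∈ fixingOutside E S, ((g : Matrix m m K) *ᵥ v) a = 1 := by
  obtain ⟨c, hc, hvc⟩ := hv
  have hcS : c ∈ S := by
    by_contra h
    exact hvc (hvS c h)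
  by_cases hvb : v b = 0
  · by_cases hac : a ≠ c ∧ a ≠ ν c
    · exact hE.exists_unit_coordinate_of_ne_zero hS ha hc haS hcS hac.1 hac.2 hvc
    · have hac' : c = a ∨ c = ν a := by
        by_contra! h
        exact hac ⟨h.1.symm, fun h' => h.2 (by rw [h', hν])⟩
      have h3 : b ≠ c ∧ b ≠ ν c := by
        rcases hac' with rfl | rfl
        · exact ⟨hab.symm, fun h => hab' (by rw [h, hν])⟩
        · exact ⟨fun h => hab' (by rw [h, hν]), by rw [hν]; exact hab.symm⟩
      obtain ⟨g, hg, h⟩ := hE.exists_short (S := S) 1 hb hc h3.1 h3.2 hcS ((hS b).2 hbS)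
      obtain ⟨g', hg', h'⟩ := hE.exists_unit_coordinate_of_ne_zero hS ha hb haS hbS hab hab'
        (v := (g : Matrix m m K) *ᵥ v) (by
          rw [h, shortRoot_mulVec_apply]
          simp [hvb, h3.2, hvc])
      exact ⟨g' * g, Subgroup.mul_mem _ hg' hg, by
        rw [Units.val_mul, ← Matrix.mulVec_mulVec, h']⟩
  · exact hE.exists_unit_coordinate_of_ne_zero hS ha hb haS hbS hab hab' hvb

theorem exists_unit_coordinate_of_rank_one (hE : ContainsSplitGenerators σ ν a₀ E)
    {s : K} (hs : σ s = -s) (hs0 : s ≠ 0)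
    (hS : ∀ b, ν b ∈ S ↔ b ∈ S) (ha : ν a₀ ≠ a₀) (haS : a₀ ∈ S) {v : m → K}
    (hv : v a₀ ≠ 0 ∨ v (ν a₀) ≠ 0) :
    ∃ g ∈ fixingOutside E S, ((g : Matrix m m K) *ᵥ v) a₀ = 1 := by
  have key : ∃ g ∈ fixingOutside E S, ((g : Matrix m m K) *ᵥ v) a₀ ≠ 0 := by
    by_cases h0 : v a₀ = 0
    · obtain ⟨g, hg, h⟩ := hE.exists_long (S := S) ha hs ((hS a₀).2 haS)
      refine ⟨g, hg, ?_⟩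
      -- The new coordinate at a₀ is s v(-a₀).
      rw [h, longRoot_mulVec_apply]
      simpa [h0, hs0] using hv
    · exact ⟨1, Subgroup.one_mem _, by simpa using h0⟩
  obtain ⟨g, hg, h⟩ := key
  obtain ⟨g', hg', h'⟩ := hE.exists_torus (S := S) (inv_ne_zero h) haS ((hS a₀).2 haS)
  refine ⟨g' * g, Subgroup.mul_mem _ hg' hg, ?_⟩
  rw [Units.val_mul, ← Matrix.mulVec_mulVec, h', Matrix.mulVec_diagonal]
  simp [torusDiag, h]

/-- If isotropic vectors can be given the coordinate `1` at `a`, then every isometry supported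
on `S` is reduced by generators to one supported on `S \ {a, -a}`. -/
theorem exists_reduce (hE : ContainsSplitGenerators σ ν a₀ E) (hν : Function.Involutive ν)
    (h2 : ∀ o, ν o = o → (2 : K) ≠ 0) (hS : ∀ b, ν b ∈ S ↔ b ∈ S) {a : m} (ha : ν a ≠ a)
    (haS : a ∈ S)
    (hunit : ∀ v : m → K, v ≠ 0 → (∀ c, c ∉ S → v c = 0) →
      hermitianValue σ (splitForm K ν) v v = 0 →
      ∃ g ∈ fixingOutside E S, ((g : Matrix m m K) *ᵥ v) a = 1)
    {X : GL m K} (hX : X ∈ fixingOutside (unitaryGroupOf σ (splitForm K ν)) S) :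
    ∃ g ∈ E, g * X ∈ fixingOutside (unitaryGroupOf σ (splitForm K ν)) (S \ {a, ν a}) := by
  have hmul : ∀ {g Y : GL m K}, g ∈ fixingOutside E S →
      Y ∈ fixingOutside (unitaryGroupOf σ (splitForm K ν)) S →
      g * Y ∈ fixingOutside (unitaryGroupOf σ (splitForm K ν)) S :=
    fun hg hY => Subgroup.mul_mem _ ⟨hE.le_unitary hg.1, hg.2⟩ hY
  have hiso : ∀ {Y : GL m K} (b : m), ν b ≠ b →
      Y ∈ fixingOutside (unitaryGroupOf σ (splitForm K ν)) S →
      hermitianValue σ (splitForm K ν) ((Y : Matrix m m K) *ᵥ Pi.single b 1)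
        ((Y : Matrix m m K) *ᵥ Pi.single b 1) = 0 := by
    intro Y b hb hY
    rw [hermitianValue_mulVec hY.1, hermitianValue_single_left, Pi.single_eq_of_ne hb, mul_zero]
  have haS' := (hS a).2 haS
  have ha' : ν (ν a) ≠ ν a := fun h => ha (hν.injective h)
  obtain ⟨g₁, hg₁, h₁⟩ := hunit ((X : Matrix m m K) *ᵥ Pi.single a 1) (mulVec_single_ne_zero X a)
    (fun c hc => mulVec_single_apply_eq_zero hν h2 hS hX haS hc) (hiso a ha hX)
  have hX₁ := hmul hg₁ hX
  -- Applied to -a in place of a: the target is e_a.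
  obtain ⟨g₂, hg₂, h₂⟩ := hE.exists_mulVec_eq_single hν hS ha' haS'
    (v := ((g₁ * X : GL m K) : Matrix m m K) *ᵥ Pi.single a 1)
    (by rw [hν, Units.val_mul, ← Matrix.mulVec_mulVec, h₁])
    (fun c hc => mulVec_single_apply_eq_zero hν h2 hS hX₁ haS hc) (hiso a ha hX₁)
  rw [hν, Matrix.mulVec_mulVec, ← Units.val_mul] at h₂
  have hg₂' := fixingOutside_mono (E := E) Set.sdiff_subset hg₂
  have hX₂ := hmul hg₂' hX₁
  obtain ⟨g₃, hg₃, h₃⟩ := hE.exists_mulVec_eq_single hν hS ha haS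
    (v := ((g₂ * (g₁ * X) : GL m K) : Matrix m m K) *ᵥ Pi.single (ν a) 1)
    (by
      -- Since e_a is now fixed, its pairing with the image of e_{-a} is still 1, which is the
      -- coordinate at -a.
      have h := hermitianValue_mulVec hX₂.1 (Pi.single a 1) (Pi.single (ν a) 1)
      rw [h₂, hermitianValue_single_left, hermitianValue_single_left] at h
      simpa [ha] using h)
    (fun c hc => mulVec_single_apply_eq_zero hν h2 hS hX₂ haS' hc) (hiso (ν a) ha' hX₂)
  have hX₃ := hmul (fixingOutside_mono (E := E) Set.sdiff_subset hg₃) hX₂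
  refine ⟨g₃ * (g₂ * g₁), E.mul_mem hg₃.1 (E.mul_mem hg₂.1 hg₁.1), ?_⟩
  rw [mul_assoc, mul_assoc]
  refine ⟨hX₃.1, fun b hb => ?_⟩
  by_cases hbS : b ∈ S
  · have hb' : b = a ∨ b = ν a := by
      by_contra h
      exact hb ⟨hbS, h⟩
    rcases hb' with rfl | rfl
    · rw [Units.val_mul, ← Matrix.mulVec_mulVec, h₂]
      -- Clearing the image of e_{-a} does not disturb e_a, because `g₃` fixes the basis outside S \
      -- {a}.
      exact hg₃.2 b fun h => h.2 rfl
    · rw [Units.val_mul, ← Matrix.mulVec_mulVec, h₃]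
  · exact hX₃.2 b hbS

theorem mem_of_fixes_hyperbolic (hE : ContainsSplitGenerators σ ν a₀ E)
    (hν : Function.Involutive ν)
    (ho : ∀ o o', ν o = o → ν o' = o' → o = o') (h2 : ∀ o, ν o = o → (2 : K) ≠ 0)
    (hS : ∀ b, b ∈ S ↔ ν b = b)
    {X : GL m K} (hX : X ∈ fixingOutside (unitaryGroupOf σ (splitForm K ν)) S) : X ∈ E := by
  by_cases h : ∃ o, ν o = o
  · obtain ⟨o, hνo⟩ := h
    have hS' : ∀ b, b ∉ S ↔ b ≠ o := fun b => by
      rw [hS, not_iff_not]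
      exact ⟨fun hb => ho b o hb hνo, fun hb => hb ▸ hνo⟩
    set z := ((X : Matrix m m K) *ᵥ Pi.single o 1) o with hz
    have h1 : (X : Matrix m m K) *ᵥ Pi.single o 1 = Pi.single o z := by
      ext b
      by_cases hb : b = o
      · subst hb; simp [hz]
      · rw [Pi.single_eq_of_ne hb]
        refine mulVec_single_apply_eq_zero hν h2 (fun b => ?_) hX ((hS o).2 hνo) ((hS' b).2 hb)
        rw [hS, hS, hν.injective.eq_iff]
    have h3 : z * σ z = 1 := by
      have := hermitianValue_mulVec hX.1 (Pi.single o 1) (Pi.single o 1)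
      rw [h1, hermitianValue_single_self σ hνo, hermitianValue_single_self σ hνo] at this
      simpa [h2 o hνo] using this
    obtain ⟨g, hg, hgX⟩ := hE.normOne o z hνo h3
    convert hg
    apply Units.ext
    apply Matrix.ext_of_mulVec_single
    intro b
    rw [hgX]
    by_cases hb : b = o
    · subst hb
      rw [h1, Matrix.diagonal_mulVec_single]
      simp
    · rw [hX.2 b ((hS' b).2 hb), Matrix.diagonal_mulVec_single]
      simp [hb]
  · push Not at h
    convert E.one_mem
    apply Units.ext
    apply Matrix.ext_of_mulVec_single
    intro b
    rw [hX.2 b (fun hb => h b ((hS b).1 hb)), Units.val_one, Matrix.one_mulVec]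

/-- Strong induction on S. The hypothesis `haS` records that a₀ survives as long as any hyperbolic
index does, so the torus is at hand for the last plane. -/
theorem mem_of_mem_fixingOutside (hE : ContainsSplitGenerators σ ν a₀ E)
    (hν : Function.Involutive ν) (ha₀ : ν a₀ ≠ a₀)
    (ho : ∀ o o', ν o = o → ν o' = o' → o = o') (h2 : ∀ o, ν o = o → (2 : K) ≠ 0)
    {s : K} (hs : σ s = -s) (hs0 : s ≠ 0) (S : Finset m) (hS : ∀ b, ν b ∈ S ↔ b ∈ S)
    (hoS : ∀ o, ν o = o → o ∈ S) (haS : (∃ b ∈ S, ν b ≠ b) → a₀ ∈ S) {X : GL m K}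
    (hX : X ∈ fixingOutside (unitaryGroupOf σ (splitForm K ν)) (S : Set m)) : X ∈ E := by
  induction S using Finset.strongInduction generalizing X with
  | H S ih =>
    have hS' : ∀ b, ν b ∈ (S : Set m) ↔ b ∈ (S : Set m) := hS
    by_cases hb : ∃ b ∈ S, ν b ≠ b
    · have ha₀S := haS hb
      have step : ∀ a ∈ S, ν a ≠ a →
          ((∃ b ∈ S \ {a, ν a}, ν b ≠ b) → a₀ ∈ S \ {a, ν a}) →
          (∀ v : m → K, v ≠ 0 → (∀ c, c ∉ (S : Set m) → v c = 0) →
            hermitianValue σ (splitForm K ν) v v = 0 →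
            ∃ g ∈ fixingOutside E (S : Set m), ((g : Matrix m m K) *ᵥ v) a = 1) → X ∈ E := by
        intro a haS ha h hunit
        obtain ⟨g, hg, hgX⟩ := hE.exists_reduce hν h2 hS' ha haS hunit hX
        refine (E.mul_mem_cancel_left hg).1 (ih (S \ {a, ν a}) ?_ ?_ ?_ h ?_)
        · refine Finset.ssubset_iff_subset_ne.2 ⟨Finset.sdiff_subset, fun h => ?_⟩
          have : a ∈ S \ {a, ν a} := h.symm ▸ haS
          simp at this
        · intro b
          have h1 : ν b = a ↔ b = ν a := ⟨fun h => by rw [← h, hν], fun h => by rw [h, hν]⟩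
          simp [hS, h1, hν.injective.eq_iff, and_comm]
        · intro o hνo
          have h1 : o ≠ a := by rintro rfl; exact ha hνo
          have h2 : o ≠ ν a := by rintro rfl; exact ha (hν.injective hνo)
          simp [hoS o hνo, h1, h2]
        · simpa using hgX
      by_cases hb' : ∃ b ∈ S, ν b ≠ b ∧ b ≠ a₀ ∧ b ≠ ν a₀
      · obtain ⟨a, haS, ha, h1, h3⟩ := hb'
        have h4 : a₀ ≠ ν a := fun h => h3 (by rw [h, hν])
        refine step a haS ha (fun _ => by simp [ha₀S, h1.symm, h4]) fun v hv hvS hv0 => ?_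
        exact hE.exists_unit_coordinate hν hS' ha ha₀ haS ha₀S h1 h3
          (exists_hyperbolic_coordinate_ne_zero ho h2 hv hv0) hvS
      · push Not at hb'
        refine step a₀ ha₀S ha₀ ?_ fun v hv hvS hv0 => ?_
        · rintro ⟨b, hbS, hb⟩
          simp only [Finset.mem_sdiff, Finset.mem_insert, Finset.mem_singleton, not_or] at hbS
          exact absurd (hb' b hbS.1 hb hbS.2.1) hbS.2.2
        · obtain ⟨c, hc, hvc⟩ := exists_hyperbolic_coordinate_ne_zero ho h2 hv hv0
          refine hE.exists_unit_coordinate_of_rank_one hs hs0 hS' ha₀ ha₀S ?_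
          have hcS : c ∈ S := by
            by_contra h
            exact hvc (hvS c h)
          by_cases hca : c = a₀
          · exact Or.inl (hca ▸ hvc)
          · exact Or.inr (hb' c hcS hc hca ▸ hvc)
    · push Not at hb
      exact hE.mem_of_fixes_hyperbolic hν ho h2 (fun b => ⟨hb b, hoS b⟩) hX

theorem eq_unitaryGroupOf (hE : ContainsSplitGenerators σ ν a₀ E)
    (hν : Function.Involutive ν) (ha₀ : ν a₀ ≠ a₀)
    (ho : ∀ o o', ν o = o → ν o' = o' → o = o') (h2 : ∀ o, ν o = o → (2 : K) ≠ 0)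
    {s : K} (hs : σ s = -s) (hs0 : s ≠ 0) : E = unitaryGroupOf σ (splitForm K ν) :=
  le_antisymm hE.le_unitary fun X hX =>
    hE.mem_of_mem_fixingOutside hν ha₀ ho h2 hs hs0 Finset.univ (by simp) (by simp) (by simp)
      ⟨hX, by simp⟩

end ContainsSplitGenerators

end Reduction

/-! ### Norm one and skew elements of the finite field. -/

section FiniteField

variable {K : Type*} [Field K] [Fintype K] {q : ℕ} {σ : K →+* K} {ζ : Kˣ}

theorem orderOf_eq_of_zpowers_eq_top (hK : Fintype.card K = q ^ 2)
    (hζ : Subgroup.zpowers ζ = ⊤) : orderOf ζ = (q - 1) * (q + 1) := by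
  rw [← Nat.card_zpowers, hζ, Subgroup.card_top, Nat.card_units, Nat.card_eq_fintype_card, hK,
    mul_comm, ← Nat.sq_sub_sq, one_pow]

theorem one_lt_of_card_eq_sq (hK : Fintype.card K = q ^ 2) : 1 < q := by
  have := Fintype.one_lt_card (α := K)
  rw [hK] at this
  by_contra! h
  interval_cases q <;> simp at this

theorem powerMap_involutive (hK : Fintype.card K = q ^ 2) (hσ : ∀ x, σ x = x ^ q) (x : K) :
    σ (σ x) = x := by
  rw [hσ, hσ, ← pow_mul, ← sq, ← hK, FiniteField.pow_card]

theorem zpowers_eq_normOneSubgroup (hK : Fintype.card K = q ^ 2) (hσ : ∀ x, σ x = x ^ q)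
    (hζ : Subgroup.zpowers ζ = ⊤) : Subgroup.zpowers (ζ ^ (q - 1)) = normOneSubgroup σ := by
  have hq := one_lt_of_card_eq_sq hK
  have hord := orderOf_eq_of_zpowers_eq_top hK hζ
  have hmem : ∀ x : Kˣ, x ∈ normOneSubgroup σ ↔ x ^ (q + 1) = 1 := by
    intro x
    change (x : K) * σ x = 1 ↔ _
    rw [hσ, ← pow_succ', ← Units.val_pow_eq_pow_val, Units.val_eq_one]
  ext x
  rw [hmem]
  constructor
  · rintro ⟨k, rfl⟩
    change ((ζ ^ (q - 1)) ^ k) ^ (q + 1) = 1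
    rw [← zpow_natCast, zpow_comm, zpow_natCast, ← pow_mul, ← hord, pow_orderOf_eq_one, one_zpow]
  · intro hx
    obtain ⟨k, rfl⟩ : x ∈ Subgroup.zpowers ζ := hζ ▸ Subgroup.mem_top x
    change (ζ ^ k) ^ (q + 1) = 1 at hx
    rw [← zpow_natCast, ← zpow_mul, ← orderOf_dvd_iff_zpow_eq_one, hord, Nat.cast_mul] at hx
    -- Here (q - 1)(q + 1) divides k(q + 1); cancelling q + 1 leaves q - 1 dividing k.
    obtain ⟨j, rfl⟩ := Int.dvd_of_mul_dvd_mul_right (by positivity) hx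
    exact ⟨j, by simp [zpow_mul]⟩

/-- The difference ζ - ζ̄ is skew, and ζ is not fixed by the involution because its order exceeds q
- 1. In characteristic 2 this still works, skew then meaning fixed. -/
theorem exists_skew_ne_zero (hK : Fintype.card K = q ^ 2) (hσ : ∀ x, σ x = x ^ q)
    (hζ : Subgroup.zpowers ζ = ⊤) : ∃ s : K, σ s = -s ∧ s ≠ 0 := by
  have hq := one_lt_of_card_eq_sq hK
  refine ⟨(ζ : K) - σ ζ, ?_, fun h => ?_⟩
  · rw [map_sub, powerMap_involutive hK hσ, neg_sub]
  · rw [sub_eq_zero, hσ, ← Units.val_pow_eq_pow_val, Units.val_inj] at h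
    have h1 : ζ ^ (q - 1) = 1 := by
      rw [← mul_left_inj ζ, ← pow_succ, Nat.sub_add_cancel hq.le, one_mul, ← h]
    have h2 := Nat.le_of_dvd (by omega) (orderOf_dvd_of_pow_eq_one h1)
    rw [orderOf_eq_of_zpowers_eq_top hK hζ] at h2
    nlinarith [Nat.sub_pos_of_lt hq]

end FiniteField

/-- Each short root element has two descriptions, by (a, b) and by (-b, -a). This brings an
arbitrary pair to one of the listed elementary matrices, which use only i < j for mixed signs and no
pair of two negative indices. -/
theorem shortRoot_symm {K : Type*} [Field K] {m : Type*} [DecidableEq m] {σ : K →+* K}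
    (hσ : ∀ x, σ (σ x) = x) {ν : m → m} (hν : Function.Involutive ν) (a b : m) (t : K) :
    shortRoot σ ν a b t = shortRoot σ ν (ν b) (ν a) (-σ t) := by
  simp only [shortRoot, hν a, hν b, map_neg, hσ, ← Matrix.single_neg]
  abel

/-! ### From the listed generators to full root and torus families. -/

section Specialization

variable {K : Type*} [Field K] {m : Type*} [Fintype m] [DecidableEq m]

theorem exists_mem_diagonal_of_mem_zpowers {E : Subgroup (GL m K)} (f : Kˣ →* (m → K)) {ζ u : Kˣ}
    (hu : u ∈ Subgroup.zpowers ζ)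
    (h : ∃ g ∈ E, (g : Matrix m m K) = Matrix.diagonal (f ζ)) :
    ∃ g ∈ E, (g : Matrix m m K) = Matrix.diagonal (f u) := by
  let F : Kˣ →* GL m K :=
    MonoidHom.toHomUnits ((Matrix.diagonalRingHom m K).toMonoidHom.comp f)
  have hF : ∀ x, (F x : Matrix m m K) = Matrix.diagonal (f x) := fun _ => rfl
  obtain ⟨g, hg, hgζ⟩ := h
  have hg' : F ζ = g := Units.ext ((hF ζ).trans hgζ.symm)
  have h1 : Subgroup.zpowers ζ ≤ E.comap F := by
    rw [Subgroup.zpowers_le, Subgroup.mem_comap, hg']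
    exact hg
  exact ⟨F u, h1 hu, hF u⟩

/-- The torus at `a` as a homomorphism. -/
def torusHom (σ : K →+* K) (ν : m → m) (a : m) : Kˣ →* (m → K) where
  toFun z := torusDiag σ ν a z
  map_one' := by
    ext b
    simp [torusDiag]
  map_mul' x y := by
    ext b
    simp only [torusDiag, Pi.mul_apply, Units.val_mul, map_mul, mul_inv]
    split_ifs <;> simp

/-- The scalars on the basis vector at `o` as a homomorphism. -/
def coordinateHom (K : Type*) [Field K] (o : m) : Kˣ →* (m → K) where
  toFun z := Function.update (fun _ => 1) o (z : K)
  map_one' := by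
    ext b
    simp [Function.update_apply]
  map_mul' x y := by
    ext b
    simp only [Function.update_apply, Pi.mul_apply, Units.val_mul]
    split_ifs <;> simp

theorem generatedByMatrices_of_containsSplitGenerators {σ : K →+* K} {ν : m → m} {a₀ : m}
    (hν : Function.Involutive ν) (ha₀ : ν a₀ ≠ a₀)
    (ho : ∀ o o', ν o = o → ν o' = o' → o = o') (h2 : ∀ o, ν o = o → (2 : K) ≠ 0)
    {s : K} (hs : σ s = -s) (hs0 : s ≠ 0) {S : Set (Matrix m m K)}
    (hS : ∀ A ∈ S, (A.map σ)ᵀ * splitForm K ν * A = splitForm K ν)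
    (hgen : ∀ E : Subgroup (GL m K), E ≤ unitaryGroupOf σ (splitForm K ν) →
      (∀ A ∈ S, ∃ g ∈ E, (g : Matrix m m K) = A) → ContainsSplitGenerators σ ν a₀ E) :
    GeneratedByMatrices (unitaryGroupOf σ (splitForm K ν)) S := by
  have hmem : ∀ A ∈ S, ∃ g ∈ unitaryGroupOf σ (splitForm K ν), (g : Matrix m m K) = A :=
    fun A hA => exists_mem_unitaryGroupOf (isUnit_det_splitForm hν h2) (hS A hA)
  -- The criterion is applied to the closure of the given matrices.
  refine ⟨hmem, (hgen _ ?_ fun A hA => ?_).eq_unitaryGroupOf hν ha₀ ho h2 hs hs0⟩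
  · rw [Subgroup.closure_le]
    exact fun g hg => hS _ hg
  · obtain ⟨g, -, rfl⟩ := hmem A hA
    exact ⟨g, Subgroup.subset_closure hA, rfl⟩

end Specialization

/-! ### Dimension 2l, where the involution has no fixed index. -/

section Even

variable {K : Type*} [Field K] {l : ℕ}

theorem evenForm_eq_splitForm : evenForm K l = splitForm K Sum.swap := by
  ext (i | i) (j | j) <;> simp [evenForm, splitForm, Matrix.one_apply, eq_comm]

theorem hEven_eq_diagonal (σ : K →+* K) (hl : l - 1 < l) (z : K) :
    hEven σ l z = Matrix.diagonal (torusDiag σ Sum.swap (Sum.inl ⟨l - 1, hl⟩) z) := by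
  have h : ∀ i : Fin l, (i : ℕ) + 1 = l ↔ i = ⟨l - 1, hl⟩ := fun i => by
    rw [Fin.ext_iff]
    dsimp only
    omega
  rw [hEven]
  congr 1
  ext (i | i) <;> simp [torusDiag, h]

theorem sum_swap_ne (a : EvenIndex l) : Sum.swap a ≠ a := by
  rcases a with i | i <;> simp

theorem IsElementaryEven.isometry {σ : K →+* K} (hσ : ∀ x, σ (σ x) = x)
    {A : Matrix (EvenIndex l) (EvenIndex l) K} (hA : IsElementaryEven σ A) :
    (A.map σ)ᵀ * splitForm K Sum.swap * A = splitForm K Sum.swap := by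
  have hν : Function.Involutive (Sum.swap : EvenIndex l → EvenIndex l) := Sum.swap_swap
  cases hA with
  | pos_pos i j t hij =>
    exact shortRoot_isometry (a := Sum.inl i) (b := Sum.inl j) hσ hν (by simp) (by simp)
      (by simpa using hij) (by simp) t
  | pos_neg i j t hij =>
    exact shortRoot_isometry (a := Sum.inl i) (b := Sum.inr j) hσ hν (by simp) (by simp)
      (by simp) (by simpa using hij.ne) t
  | neg_pos i j t hij =>
    exact shortRoot_isometry (a := Sum.inr i) (b := Sum.inl j) hσ hν (by simp) (by simp)
      (by simp) (by simpa using hij.ne) t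
  | pos_neg_self i s hs => exact longRoot_isometry (a := Sum.inl i) hν (by simp) hs
  | neg_pos_self i s hs => exact longRoot_isometry (a := Sum.inr i) hν (by simp) hs

theorem isElementaryEven_shortRoot {σ : K →+* K} (hσ : ∀ x, σ (σ x) = x) {a b : EvenIndex l}
    (hab : a ≠ b) (hab' : a ≠ Sum.swap b) (t : K) :
    IsElementaryEven σ (shortRoot σ Sum.swap a b t) := by
  have hν : Function.Involutive (Sum.swap : EvenIndex l → EvenIndex l) := Sum.swap_swap
  rcases a with i | i <;> rcases b with j | j
  · exact .pos_pos i j t (by simpa using hab)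
  · have hij : i ≠ j := by simpa using hab'
    rcases hij.lt_or_gt with h | h
    · exact .pos_neg i j t h
    · rw [shortRoot_symm hσ hν]
      exact .pos_neg j i _ h
  · have hij : i ≠ j := by simpa using hab'
    rcases hij.lt_or_gt with h | h
    · exact .neg_pos i j t h
    · rw [shortRoot_symm hσ hν]
      exact .neg_pos j i _ h
  · rw [shortRoot_symm hσ hν]
    exact .pos_pos j i _ (by simpa using hab.symm)

theorem isElementaryEven_longRoot {σ : K →+* K} (a : EvenIndex l) {s : K} (hs : σ s = -s) :
    IsElementaryEven σ (longRoot Sum.swap a s) := by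
  rcases a with i | i
  · exact .pos_neg_self i s hs
  · exact .neg_pos_self i s hs

theorem generatedByMatrices_even {σ : K →+* K} (hσ : ∀ x, σ (σ x) = x) (hl : 0 < l) {ζ : Kˣ}
    (hζ : Subgroup.zpowers ζ = ⊤) {s : K} (hs : σ s = -s) (hs0 : s ≠ 0) :
    GeneratedByMatrices (unitaryGroupOf σ (evenForm K l))
      ({A | IsElementaryEven σ A} ∪ {hEven σ l (ζ : K)}) := by
  have hν : Function.Involutive (Sum.swap : EvenIndex l → EvenIndex l) := Sum.swap_swap
  have hl' : l - 1 < l := by omega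
  have ha₀ := sum_swap_ne (l := l) (Sum.inl ⟨l - 1, hl'⟩)
  rw [evenForm_eq_splitForm]
  refine generatedByMatrices_of_containsSplitGenerators (a₀ := Sum.inl ⟨l - 1, hl'⟩) hν ha₀
    (fun o _ h => absurd h (sum_swap_ne o)) (fun o h => absurd h (sum_swap_ne o)) hs hs0 ?_ ?_
  · rintro A (hA | rfl)
    · exact IsElementaryEven.isometry hσ hA
    · rw [hEven_eq_diagonal σ hl']
      exact torusDiag_isometry hσ hν ha₀ ζ.ne_zero
  · intro E hE h
    exact {
      le_unitary := hE
      short := fun a b t _ _ hab hab' => h _ (Or.inl (isElementaryEven_shortRoot hσ hab hab' t))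
      long := fun a s _ hs => h _ (Or.inl (isElementaryEven_longRoot a hs))
      extra := fun o _ _ h => absurd h (sum_swap_ne o)
      torus := fun z hz => exists_mem_diagonal_of_mem_zpowers (torusHom σ _ _) (ζ := ζ)
        (u := Units.mk0 z hz) (hζ ▸ Subgroup.mem_top _)
        (h _ (Or.inr (hEven_eq_diagonal σ hl' ζ).symm))
      normOne := fun o _ h => absurd h (sum_swap_ne o) }

end Even

/-! ### Dimension 2l + 1, where the index 0 is the only fixed one. -/

section Odd

variable {K : Type*} [Field K] {l : ℕ}

/-- The involution `a ↦ -a` of the index set of size `2l + 1`. -/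
def oddNeg : OddIndex l → OddIndex l := Sum.map id Sum.swap

theorem oddNeg_involutive : Function.Involutive (oddNeg (l := l)) := by
  rintro (o | i | i) <;> rfl

theorem oddNeg_inr_ne (a : EvenIndex l) : oddNeg (Sum.inr a) ≠ Sum.inr a := by
  simpa [oddNeg] using sum_swap_ne a

theorem oddNeg_eq_self_iff {a : OddIndex l} : oddNeg a = a ↔ a = OddIndex.zero := by
  rcases a with o | a
  · simp [oddNeg]
  · simpa using oddNeg_inr_ne a

theorem oddForm_eq_splitForm : oddForm K l = splitForm K oddNeg := by
  ext (i | i | i) (j | j | j) <;>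
    simp [oddForm, evenForm, splitForm, oddNeg, Matrix.one_apply, eq_comm]

theorem hOdd_eq_diagonal (σ : K →+* K) (hl : l - 1 < l) (z : K) :
    hOdd σ l z = Matrix.diagonal (torusDiag σ oddNeg (Sum.inr (Sum.inl ⟨l - 1, hl⟩)) z) := by
  rw [hOdd, hEven_eq_diagonal σ hl, ← Matrix.diagonal_one, Matrix.fromBlocks_diagonal]
  congr 1
  ext (i | i | i) <;> simp [torusDiag, oddNeg]

theorem hZero_eq_diagonal (z : K) :
    hZero l z = Matrix.diagonal (Function.update (fun _ => 1) OddIndex.zero z) := by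
  rw [hZero]
  congr 1
  ext (i | i) <;> simp

theorem IsElementaryOdd.isometry {σ : K →+* K} (hσ : ∀ x, σ (σ x) = x)
    {A : Matrix (OddIndex l) (OddIndex l) K} (hA : IsElementaryOdd σ A) :
    (A.map σ)ᵀ * splitForm K oddNeg * A = splitForm K oddNeg := by
  have hν := oddNeg_involutive (l := l)
  cases hA with
  | pos_pos i j t hij =>
    exact shortRoot_isometry (a := OddIndex.pos i) (b := OddIndex.pos j) hσ hν
      (oddNeg_inr_ne _) (oddNeg_inr_ne _) (by simpa using hij) (by simp [oddNeg]) t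
  | pos_neg i j t hij =>
    exact shortRoot_isometry (a := OddIndex.pos i) (b := OddIndex.neg j) hσ hν
      (oddNeg_inr_ne _) (oddNeg_inr_ne _) (by simp) (by simpa [oddNeg] using hij.ne) t
  | neg_pos i j t hij =>
    exact shortRoot_isometry (a := OddIndex.neg i) (b := OddIndex.pos j) hσ hν
      (oddNeg_inr_ne _) (oddNeg_inr_ne _) (by simp) (by simpa [oddNeg] using hij.ne) t
  | pos_neg_self i s hs =>
    exact longRoot_isometry (a := OddIndex.pos i) hν (oddNeg_inr_ne _) hs
  | neg_pos_self i s hs =>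
    exact longRoot_isometry (a := OddIndex.neg i) hν (oddNeg_inr_ne _) hs
  | pos_zero i t =>
    exact extraRoot_isometry (a := OddIndex.pos i) (o := OddIndex.zero) hσ hν rfl
      (oddNeg_inr_ne _) t
  | zero_pos i t =>
    have h := extraRoot_isometry (a := OddIndex.neg i) (o := OddIndex.zero) hσ hν rfl
      (oddNeg_inr_ne _) t
    -- The elementary matrix has the same summands in another order.
    rw [extraRoot, sub_add_eq_add_sub] at h
    exact h

theorem isElementaryOdd_shortRoot {σ : K →+* K} (hσ : ∀ x, σ (σ x) = x) {a b : EvenIndex l}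
    (hab : a ≠ b) (hab' : a ≠ Sum.swap b) (t : K) :
    IsElementaryOdd σ (shortRoot σ oddNeg (Sum.inr a) (Sum.inr b) t) := by
  have hν := oddNeg_involutive (l := l)
  rcases a with i | i <;> rcases b with j | j
  · exact .pos_pos i j t (by simpa using hab)
  · have hij : i ≠ j := by simpa using hab'
    rcases hij.lt_or_gt with h | h
    · exact .pos_neg i j t h
    · rw [shortRoot_symm hσ hν]
      exact .pos_neg j i _ h
  · have hij : i ≠ j := by simpa using hab'
    rcases hij.lt_or_gt with h | h
    · exact .neg_pos i j t h
    · rw [shortRoot_symm hσ hν]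
      exact .neg_pos j i _ h
  · rw [shortRoot_symm hσ hν]
    exact .pos_pos j i _ (by simpa using hab.symm)

theorem isElementaryOdd_longRoot {σ : K →+* K} (a : EvenIndex l) {s : K} (hs : σ s = -s) :
    IsElementaryOdd σ (longRoot oddNeg (Sum.inr a) s) := by
  rcases a with i | i
  · exact .pos_neg_self i s hs
  · exact .neg_pos_self i s hs

theorem isElementaryOdd_extraRoot (σ : K →+* K) (a : EvenIndex l) (t : K) :
    IsElementaryOdd σ (extraRoot σ oddNeg OddIndex.zero (Sum.inr a) t) := by
  rcases a with i | i
  · exact .pos_zero i t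
  · rw [extraRoot, sub_add_eq_add_sub]
    exact .zero_pos i t

theorem generatedByMatrices_odd {σ : K →+* K} (hσ : ∀ x, σ (σ x) = x) (h2 : (2 : K) ≠ 0)
    (hl : 0 < l) {ζ ζ₁ : Kˣ} (hζ : Subgroup.zpowers ζ = ⊤)
    (hζ₁ : Subgroup.zpowers ζ₁ = normOneSubgroup σ) {s : K} (hs : σ s = -s) (hs0 : s ≠ 0) :
    GeneratedByMatrices (unitaryGroupOf σ (oddForm K l))
      ({A | IsElementaryOdd σ A} ∪ {hOdd σ l (ζ : K), hZero l (ζ₁ : K)}) := by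
  have hν := oddNeg_involutive (l := l)
  have hl' : l - 1 < l := by omega
  have ha₀ := oddNeg_inr_ne (l := l) (Sum.inl ⟨l - 1, hl'⟩)
  rw [oddForm_eq_splitForm]
  refine generatedByMatrices_of_containsSplitGenerators (a₀ := Sum.inr (Sum.inl ⟨l - 1, hl'⟩))
    hν ha₀ (fun o o' h h' => (oddNeg_eq_self_iff.1 h).trans (oddNeg_eq_self_iff.1 h').symm)
    (fun _ _ => h2) hs hs0 ?_ ?_
  · rintro A (hA | rfl | rfl)
    · exact IsElementaryOdd.isometry hσ hA
    · rw [hOdd_eq_diagonal σ hl']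
      exact torusDiag_isometry hσ hν ha₀ ζ.ne_zero
    · rw [hZero_eq_diagonal]
      have h : ζ₁ ∈ normOneSubgroup σ := hζ₁ ▸ Subgroup.mem_zpowers ζ₁
      exact normOneDiag_isometry hν rfl h
  · intro E hE h
    refine
      { le_unitary := hE
        short := ?_
        long := ?_
        extra := ?_
        torus := fun z hz => exists_mem_diagonal_of_mem_zpowers (torusHom σ _ _) (ζ := ζ)
          (u := Units.mk0 z hz) (hζ ▸ Subgroup.mem_top _)
          (h _ (Or.inr (Or.inl (hOdd_eq_diagonal σ hl' ζ).symm)))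
        normOne := ?_ }
    · rintro (a | a) (b | b) t ha hb hab hab'
      · exact absurd rfl ha
      · exact absurd rfl ha
      · exact absurd rfl hb
      · exact h _ (Or.inl (isElementaryOdd_shortRoot hσ (fun h => hab (congrArg Sum.inr h))
          (fun h => hab' (congrArg Sum.inr h)) t))
    · rintro (a | a) s ha hs
      · exact absurd rfl ha
      · exact h _ (Or.inl (isElementaryOdd_longRoot a hs))
    · rintro o (a | a) t ho ha
      · exact absurd rfl ha
      · obtain rfl := oddNeg_eq_self_iff.1 ho
        exact h _ (Or.inl (isElementaryOdd_extraRoot σ a t))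
    · intro o z ho hz
      obtain rfl := oddNeg_eq_self_iff.1 ho
      have hmem : Units.mk0 z (left_ne_zero_of_mul_eq_one hz) ∈ Subgroup.zpowers ζ₁ := by
        rw [hζ₁]
        exact hz
      exact exists_mem_diagonal_of_mem_zpowers (coordinateHom K OddIndex.zero) hmem
        (h _ (Or.inr (Or.inr (hZero_eq_diagonal (ζ₁ : K)).symm)))

end Odd

/-! ### The theorem for the finite field with q² elements, q = p^n. -/

theorem mainTheorem2 {K : Type*} [Field K] [Fintype K] (p n : ℕ) [Fact p.Prime] [CharP K p]
    (hK : Fintype.card K = (p ^ n) ^ 2) (σ : K →+* K) (hσ : σ = iterateFrobenius K p n)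
    (l : ℕ) (hl : 2 ≤ l) (ζ : Kˣ) (hζ : Subgroup.zpowers ζ = ⊤)
    (ζ₁ : Kˣ) (hζ₁ : ζ₁ = ζ ^ (p ^ n - 1)) :
    Subgroup.zpowers ζ₁ = normOneSubgroup σ ∧
    GeneratedByMatrices (unitaryGroupOf σ (evenForm K l))
      ({A | IsElementaryEven σ A} ∪ {hEven σ l (ζ : K)}) ∧
    (p ≠ 2 → GeneratedByMatrices (unitaryGroupOf σ (oddForm K l))
      ({A | IsElementaryOdd σ A} ∪ {hOdd σ l (ζ : K), hZero l (ζ₁ : K)})) := by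
  have hpow : ∀ x, σ x = x ^ p ^ n := fun x => by rw [hσ, iterateFrobenius_def]
  have hinv := powerMap_involutive hK hpow
  have hnorm : Subgroup.zpowers ζ₁ = normOneSubgroup σ :=
    hζ₁ ▸ zpowers_eq_normOneSubgroup hK hpow hζ
  obtain ⟨s, hs, hs0⟩ := exists_skew_ne_zero hK hpow hζ
  exact ⟨hnorm, generatedByMatrices_even hinv (by omega) hζ hs hs0, fun hp =>
    generatedByMatrices_odd hinv (Ring.two_ne_zero (by rwa [ringChar.eq K p])) (by omega) hζ hnorm
      hs hs0⟩
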